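/- Let $M$ be a first-order structure (in an arbitrary language) that is NIP, i.e. no formula $\varphi(x;y)$ has the independence property in $M$. Let $\kappa$ be an infinite cardinal such that $M$ is $\kappa$-saturated, and let $A \subseteq M$ be a set of fewer than $\kappa$ parameters. Let $K$ be an infinite field of prime characteristic $p$ that is type-definable over $A$ in $M$, i.e. the underlying set of $K$ is a subset of some finite power $M^n$ defined by a partial type over $A$, and the graphs of addition and multiplication of $K$ are likewise defined by partial types over $A$. Then $p$ does not divide the degree $[F:K]$ of any finite separable field extension $F/K$. -/

import Mathlib

namespace FirstOrder.Language

open Cardinal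

universe u v w w'

variable (L : Language.{u, v}) (M : Type w) [L.Structure M]

/-- The partitioned formula `φ(x; y)` has the independence property in `M`: for every `N` there are
tuples `a i` (`i < N`) and `b S` (`S ⊆ {0, …, N - 1}`) in `M` with `φ(a i; b S)` iff `i ∈ S`.
For each `N` this is a first-order condition, so it depends only on the theory of `M`. -/
def HasIP {L : Language.{u, v}} {m k : ℕ} (φ : L.Formula (Fin m ⊕ Fin k)) (M : Type w)
    [L.Structure M] : Prop :=
  ∀ N : ℕ, ∃ (a : Fin N → Fin m → M) (b : Set (Fin N) → Fin k → M),
    ∀ (i : Fin N) (S : Set (Fin N)), φ.Realize (Sum.elim (a i) (b S)) ↔ i ∈ S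

/-- `M` is an NIP structure (its complete theory is NIP): no formula has the independence
property. -/
def IsNIP : Prop :=
  ∀ (m k : ℕ) (φ : L.Formula (Fin m ⊕ Fin k)), ¬ HasIP φ M

/-- `M` is `κ`-saturated: every partial type in finitely many variables over a set of fewer than `κ`
parameters which is finitely satisfiable in `M` is realized in `M`. -/
def IsSaturated (κ : Cardinal.{w}) : Prop :=
  ∀ B : Set M, #B < κ → ∀ (n : ℕ) (Γ : Set (L[[B]].Formula (Fin n))),
    (∀ Γ₀ : Finset (L[[B]].Formula (Fin n)), (Γ₀ : Set (L[[B]].Formula (Fin n))) ⊆ Γ →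
      ∃ x : Fin n → M, ∀ φ ∈ Γ₀, φ.Realize x) →
    ∃ x : Fin n → M, ∀ φ ∈ Γ, φ.Realize x

variable {M}

/-- A set of tuples is type-definable over `A` when it is the set of realizations of a partial type
over `A`, i.e. an intersection of `A`-definable sets. -/
def TypeDefinable (A : Set M) {α : Type w'} (X : Set (α → M)) : Prop :=
  ∃ Γ : Set (L[[A]].Formula α), X = {x | ∀ φ ∈ Γ, φ.Realize x}

/-- The map `e` identifies the field `K` with a field which is type-definable over `A`: its universe
is a type-definable set of `n`-tuples of `M`, and the graphs of its addition and multiplication are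
type-definable (as is automatic when they are induced by definable functions or relations). -/
structure IsTypeDefinableField (A : Set M) {K : Type w'} [Field K] {n : ℕ} (e : K → Fin n → M) :
    Prop where
  injective : Function.Injective e
  carrier : L.TypeDefinable A (Set.range e)
  add : L.TypeDefinable A
    (Set.range fun z : K × K => Sum.elim (e z.1) (Sum.elim (e z.2) (e (z.1 + z.2))))
  mul : L.TypeDefinable A
    (Set.range fun z : K × K => Sum.elim (e z.1) (Sum.elim (e z.2) (e (z.1 * z.2))))

end FirstOrder.Language

/-! Write ℘(x) = x^p - x. It is enough that ℘ is onto on every finite extension E of K. For suppose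
p divides [F:K]. The Galois group of the normal closure then has an element τ of order p, with fixed
field E, and some y satisfies τ y = y + 1. Then ℘(y) lies in E, so ℘(y) = ℘(z) with z in E, and y -
z lies in the prime field: so τ fixes y, a contradiction
(`not_dvd_finrank_of_artinSchreier_surjective`).

For surjectivity (`IsTypeDefinableField.artinSchreier_surjective`), suppose c is not in ℘(E). The
relations "xy ∈ c + ℘(E)" and "xy ∈ ℘(E)" are disjoint. By saturation both are type-definable, and a
definable D separates them. For β_1, ..., β_N independent over the prime field, invertibility of the
Moore matrix gives, for each set S of indices, a t with β_i^(p^N) t in c + ℘(E) for i ∈ S and in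
℘(E) otherwise (`exists_forall_mul_sub_mem_range`). Thus D shatters sets of every finite size,
contradicting NIP. -/

namespace FirstOrder.Language

open Cardinal Set

/-! ### Type-definable sets in saturated structures -/

section SmallTypeDefinable

universe u v w

variable {L : Language.{u, v}} {M : Type w} [L.Structure M]

/-- In an NIP structure no definable relation between finite tuples shatters arbitrarily large
finite sets. -/
theorem IsNIP.exists_not_shatters (hNIP : L.IsNIP M) {α β : Type} [Finite α] [Finite β]
    {A : Set M} {D : Set (α ⊕ β → M)} (hD : A.Definable L D) :
    ∃ N : ℕ, ¬ ∃ (a : Fin N → α → M) (b : Set (Fin N) → β → M),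
      ∀ i S, Sum.elim (a i) (b S) ∈ D ↔ i ∈ S := by
  obtain ⟨A₀, -, hD⟩ := definable_iff_finitely_definable.1 hD
  obtain ⟨ψ, rfl⟩ := definable_iff_exists_formula_sum.1 hD
  obtain ⟨m, ⟨f⟩⟩ := Finite.exists_equiv_fin α
  obtain ⟨k, ⟨g⟩⟩ := Finite.exists_equiv_fin ((A₀ : Set M) ⊕ β)
  -- The finitely many parameters become variables of the second block, leaving a parameter-free
  -- formula.
  let r : (A₀ : Set M) ⊕ (α ⊕ β) → Fin m ⊕ Fin k :=
    Sum.elim (fun x => Sum.inr (g (Sum.inl x)))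
      (Sum.elim (fun x => Sum.inl (f x)) (fun x => Sum.inr (g (Sum.inr x))))
  by_contra! H
  refine hNIP m k (ψ.relabel r) fun N => ?_
  obtain ⟨a, b, hab⟩ := H N
  refine ⟨fun i => a i ∘ f.symm,
    fun S => Sum.elim (Subtype.val : ↥(A₀ : Set M) → M) (b S) ∘ g.symm, fun i S => ?_⟩
  rw [← hab i S, Formula.realize_relabel, mem_ofPred_eq]
  have : Sum.elim (a i ∘ f.symm) (Sum.elim (Subtype.val : ↥(A₀ : Set M) → M) (b S) ∘ g.symm) ∘ r
      = Sum.elim (Subtype.val : ↥(A₀ : Set M) → M) (Sum.elim (a i) (b S)) := by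
    funext x
    rcases x with x | x | x <;> simp [r]
  rw [this]

/-- A set of tuples is small type-definable (relative to `κ`) when it is an intersection of sets
definable over one set of fewer than `κ` parameters. -/
def SmallTypeDefinable (L : Language.{u, v}) {M : Type w} [L.Structure M] (κ : Cardinal.{w})
    {α : Type} (X : Set (α → M)) : Prop :=
  ∃ B : Set M, #B < κ ∧ ∃ 𝒟 : Set (Set (α → M)), (∀ D ∈ 𝒟, B.Definable L D) ∧ X = ⋂₀ 𝒟

variable {κ : Cardinal.{w}}

theorem TypeDefinable.small {A : Set M} (hA : #A < κ) {α : Type} {X : Set (α → M)}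
    (hX : L.TypeDefinable A X) : L.SmallTypeDefinable κ X := by
  obtain ⟨Γ, rfl⟩ := hX
  refine ⟨A, hA, (fun φ : L[[A]].Formula α => Set.ofPred φ.Realize) '' Γ, ?_, ?_⟩
  · rintro _ ⟨φ, -, rfl⟩
    exact ⟨φ, rfl⟩
  · ext x
    simp

theorem mk_union_lt (hκ : ℵ₀ ≤ κ) {B C : Set M} (hB : #B < κ) (hC : #C < κ) :
    #(B ∪ C : Set M) < κ :=
  (mk_union_le B C).trans_lt (add_lt_of_lt hκ hB hC)

theorem mk_range_lt (hκ : ℵ₀ ≤ κ) {α : Type} [Finite α] (x : α → M) : #(range x) < κ :=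
  ((finite_range x).lt_aleph0).trans_le hκ

theorem definable_singleton_tuple {α : Type} [Finite α] (x : α → M) :
    (range x).Definable L {x} := by
  have h (i : α) : (range x).Definable L {y : α → M | y i = x i} := by
    have := (Definable.singleton_of_mem (L := L) (mem_range_self (f := x) i)).preimage_comp
      (fun _ : Fin 1 => i)
    convert! this using 1
  convert! definable_iInter_of_finite h using 1
  ext y
  simp [funext_iff]

theorem SmallTypeDefinable.singleton (hκ : ℵ₀ ≤ κ) {α : Type} [Finite α] (x : α → M) :
    L.SmallTypeDefinable κ {x} :=
  ⟨range x, mk_range_lt hκ x, {{x}}, by simpa using definable_singleton_tuple x, by simp⟩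

theorem SmallTypeDefinable.univ (hκ : ℵ₀ ≤ κ) {α : Type} :
    L.SmallTypeDefinable κ (univ : Set (α → M)) :=
  ⟨∅, by simpa using aleph0_pos.trans_le hκ, ∅, by simp, by simp⟩

theorem SmallTypeDefinable.inter (hκ : ℵ₀ ≤ κ) {α : Type} {X Y : Set (α → M)}
    (hX : L.SmallTypeDefinable κ X) (hY : L.SmallTypeDefinable κ Y) :
    L.SmallTypeDefinable κ (X ∩ Y) := by
  obtain ⟨B, hB, 𝒟, h𝒟, rfl⟩ := hX
  obtain ⟨C, hC, ℰ, hℰ, rfl⟩ := hY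
  refine ⟨B ∪ C, mk_union_lt hκ hB hC, 𝒟 ∪ ℰ, ?_, (sInter_union _ _).symm⟩
  rintro D (hD | hD)
  · exact (h𝒟 D hD).mono subset_union_left
  · exact (hℰ D hD).mono subset_union_right

theorem SmallTypeDefinable.biInter (hκ : ℵ₀ ≤ κ) {α ι : Type} (s : Finset ι)
    {X : ι → Set (α → M)} (hX : ∀ i, L.SmallTypeDefinable κ (X i)) :
    L.SmallTypeDefinable κ (⋂ i ∈ s, X i) := by
  classical
  induction s using Finset.induction_on with
  | empty => simpa using SmallTypeDefinable.univ hκ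
  | insert i s _ ih =>
    rw [Finset.set_biInter_insert]
    exact (hX i).inter hκ ih

theorem SmallTypeDefinable.preimage_comp {α β : Type} (f : α → β) {X : Set (α → M)}
    (hX : L.SmallTypeDefinable κ X) :
    L.SmallTypeDefinable κ ((fun x : β → M => x ∘ f) ⁻¹' X) := by
  obtain ⟨B, hB, 𝒟, h𝒟, rfl⟩ := hX
  refine ⟨B, hB, (fun D => (fun x : β → M => x ∘ f) ⁻¹' D) '' 𝒟, ?_, ?_⟩
  · rintro _ ⟨D, hD, rfl⟩
    exact (h𝒟 D hD).preimage_comp f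
  · ext x
    simp

/-- Saturation in terms of definable sets. -/
theorem IsSaturated.sInter_nonempty (hM : L.IsSaturated M κ) {α : Type} [Finite α] {B : Set M}
    (hB : #B < κ) {𝒟 : Set (Set (α → M))} (h𝒟 : ∀ D ∈ 𝒟, B.Definable L D)
    (hfin : ∀ 𝒟₀ : Set (Set (α → M)), 𝒟₀.Finite → 𝒟₀ ⊆ 𝒟 → (⋂₀ 𝒟₀).Nonempty) :
    (⋂₀ 𝒟).Nonempty := by
  classical
  obtain ⟨n, ⟨f⟩⟩ := Finite.exists_equiv_fin α
  let Γ : Set (L[[B]].Formula (Fin n)) :=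
    {φ | Set.ofPred (φ.relabel f.symm).Realize ∈ 𝒟}
  obtain ⟨x, hx⟩ := hM B hB n Γ fun Γ₀ hΓ₀ => by
    obtain ⟨x, hx⟩ := hfin
      ((fun φ : L[[B]].Formula (Fin n) => Set.ofPred (φ.relabel f.symm).Realize) '' Γ₀)
      (Γ₀.finite_toSet.image _) (by rintro _ ⟨φ, hφ, rfl⟩; exact hΓ₀ hφ)
    refine ⟨x ∘ f.symm, fun φ hφ => ?_⟩
    have := hx _ ⟨φ, hφ, rfl⟩
    rwa [mem_ofPred_eq, Formula.realize_relabel] at this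
  refine ⟨x ∘ f, fun D hD => ?_⟩
  obtain ⟨φ, rfl⟩ := h𝒟 D hD
  have := hx (φ.relabel f) (by
    change Set.ofPred ((φ.relabel f).relabel f.symm).Realize ∈ 𝒟
    convert! hD using 1
    ext y
    rw [mem_ofPred_eq, mem_ofPred_eq, Formula.realize_relabel, Formula.realize_relabel,
      Function.comp_assoc, f.symm_comp_self, Function.comp_id])
  rwa [Formula.realize_relabel] at this

/-- Saturation lets the existential quantifier pass through the intersection: if x lies in the
projection of every finite subintersection, the fibre over x is finitely consistent with the whole
family, hence meets it. -/
theorem SmallTypeDefinable.image_comp (hκ : ℵ₀ ≤ κ) (hM : L.IsSaturated M κ) {α β : Type}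
    [Finite α] [Finite β] (f : α → β) {X : Set (β → M)} (hX : L.SmallTypeDefinable κ X) :
    L.SmallTypeDefinable κ ((fun x : β → M => x ∘ f) '' X) := by
  obtain ⟨B, hB, 𝒟, h𝒟, rfl⟩ := hX
  have hdef (𝒟₀ : Set (Set (β → M))) (hfin : 𝒟₀.Finite) (hsub : 𝒟₀ ⊆ 𝒟) :
      B.Definable L (⋂₀ 𝒟₀) := by
    have := hfin.to_subtype
    rw [sInter_eq_iInter]
    exact definable_iInter_of_finite fun D => h𝒟 _ (hsub D.2)
  refine ⟨B, hB, {E | ∃ 𝒟₀ : Set (Set (β → M)), 𝒟₀.Finite ∧ 𝒟₀ ⊆ 𝒟 ∧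
    E = (fun x : β → M => x ∘ f) '' ⋂₀ 𝒟₀}, ?_, Subset.antisymm ?_ ?_⟩
  · rintro _ ⟨𝒟₀, hfin, hsub, rfl⟩
    exact (hdef 𝒟₀ hfin hsub).image_comp f
  · rintro _ ⟨y, hy, rfl⟩ _ ⟨𝒟₀, -, hsub, rfl⟩
    exact ⟨y, fun D hD => hy D (hsub hD), rfl⟩
  · intro x hx
    have hfib : (B ∪ range x).Definable L ((fun y : β → M => y ∘ f) ⁻¹' {x}) :=
      ((definable_singleton_tuple x).mono subset_union_right).preimage_comp f
    obtain ⟨y, hy⟩ := hM.sInter_nonempty (mk_union_lt hκ hB (mk_range_lt hκ x))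
      (𝒟 := insert ((fun y : β → M => y ∘ f) ⁻¹' {x}) 𝒟)
      (by
        rintro D (rfl | hD)
        · exact hfib
        · exact (h𝒟 D hD).mono subset_union_left)
      (fun 𝒟₀ hfin hsub => by
        obtain ⟨y, hy, hyx⟩ := hx _ ⟨𝒟₀ ∩ 𝒟, hfin.inter_of_left _, inter_subset_right, rfl⟩
        refine ⟨y, fun D hD => ?_⟩
        rcases hsub hD with rfl | hD'
        · exact hyx
        · exact hy D ⟨hD, hD'⟩)
    exact ⟨y, fun D hD => hy D (mem_insert_of_mem _ hD), hy _ (mem_insert _ _)⟩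

/-- Disjoint small type-definable sets are separated by a definable set. -/
theorem SmallTypeDefinable.exists_separating (hκ : ℵ₀ ≤ κ) (hM : L.IsSaturated M κ) {α : Type}
    [Finite α] {X Y : Set (α → M)} (hX : L.SmallTypeDefinable κ X)
    (hY : L.SmallTypeDefinable κ Y) (hXY : Disjoint X Y) :
    ∃ (B : Set M) (D : Set (α → M)), B.Definable L D ∧ X ⊆ D ∧ Disjoint D Y := by
  obtain ⟨B, hB, 𝒟, h𝒟, rfl⟩ := hX
  obtain ⟨C, hC, ℰ, hℰ, rfl⟩ := hY
  by_contra! H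
  -- If nothing separates, every finite intersection from `𝒟` meets all of `⋂₀ ℰ`, so `𝒟 ∪ ℰ` is
  -- finitely consistent.
  obtain ⟨x, hx⟩ := hM.sInter_nonempty (mk_union_lt hκ hB hC) (𝒟 := 𝒟 ∪ ℰ)
    (by
      rintro D (hD | hD)
      · exact (h𝒟 D hD).mono subset_union_left
      · exact (hℰ D hD).mono subset_union_right)
    (fun 𝒟₀ hfin hsub => by
      have hdef : B.Definable L (⋂₀ (𝒟₀ ∩ 𝒟)) := by
        have := (hfin.inter_of_left 𝒟).to_subtype
        rw [sInter_eq_iInter]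
        exact definable_iInter_of_finite fun D => h𝒟 _ D.2.2
      obtain ⟨x, hx, hx'⟩ := not_disjoint_iff.1 (H B _ hdef (sInter_subset_sInter inter_subset_right))
      refine ⟨x, fun D hD => ?_⟩
      rcases hsub hD with hD' | hD'
      · exact hx D ⟨hD, hD'⟩
      · exact hx' D hD')
  exact disjoint_left.1 hXY (fun D hD => hx D (Or.inl hD)) (fun D hD => hx D (Or.inr hD))

end SmallTypeDefinable

end FirstOrder.Language

/-! ### The Artin–Schreier map and Moore matrices -/

theorem exists_linearIndependent_of_infinite {E : Type*} [Field E] [Infinite E] {p : ℕ}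
    [Fact p.Prime] [Algebra (ZMod p) E] (N : ℕ) :
    ∃ β : Fin N → E, LinearIndependent (ZMod p) β := by
  let b := Module.Basis.ofVectorSpace (ZMod p) E
  have : Infinite (Module.Basis.ofVectorSpaceIndex (ZMod p) E) := by
    by_contra h
    have := not_infinite_iff_finite.1 h
    have := Module.Finite.of_basis b
    have : Finite E := Module.finite_of_finite (ZMod p)
    exact not_finite E
  exact ⟨_, b.linearIndependent.comp
    (fun i : Fin N => Infinite.natEmbedding _ (i : ℕ))
    ((Infinite.natEmbedding _).injective.comp Fin.val_injective)⟩

section ArtinSchreier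

variable (E : Type*) [Field E] (p : ℕ) [Fact p.Prime] [CharP E p]

/-- The Artin–Schreier map `x ↦ x ^ p - x`. -/
def artinSchreierHom : E →+ E :=
  (frobenius E p : E →+* E).toAddMonoidHom - AddMonoidHom.id E

variable {E}

@[simp]
theorem artinSchreierHom_apply (x : E) : artinSchreierHom E p x = x ^ p - x := rfl

theorem pow_char_pow_sub_self_mem_range (x : E) (k : ℕ) :
    x ^ p ^ k - x ∈ (artinSchreierHom E p).range := by
  induction k with
  | zero => simp
  | succ k ih =>
    have h : x ^ p ^ (k + 1) - x ^ p ^ k ∈ (artinSchreierHom E p).range :=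
      ⟨x ^ p ^ k, by rw [artinSchreierHom_apply, ← pow_mul, pow_succ]⟩
    simpa using add_mem h ih

/-- The Moore matrix of elements which are linearly independent over the prime field is
invertible. -/
theorem det_moore_ne_zero [Algebra (ZMod p) E] {N : ℕ} {β : Fin N → E}
    (hβ : LinearIndependent (ZMod p) β) :
    (Matrix.of fun i l : Fin N => β i ^ p ^ (l : ℕ)).det ≠ 0 := by
  intro hdet
  obtain ⟨v, hv, hvM⟩ := Matrix.exists_mulVec_eq_zero_iff.2 hdet
  have hp : p.Prime := Fact.out
  -- A kernel vector gives an additive polynomial of degree below p^N that vanishes on the span of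
  -- the `β i`, which has p^N elements.
  let P : Polynomial E := ∑ l : Fin N, Polynomial.monomial (p ^ (l : ℕ)) (v l)
  have heval (x : E) : P.eval x = ∑ l : Fin N, v l * x ^ p ^ (l : ℕ) := by
    simp [P, Polynomial.eval_finsetSum]
  have hβ0 (i : Fin N) : ∑ l : Fin N, v l * β i ^ p ^ (l : ℕ) = 0 := by
    simpa [Matrix.mulVec, dotProduct, mul_comm] using congrFun hvM i
  have hP : P = 0 := by
    refine Polynomial.eq_zero_of_natDegree_lt_card_of_eval_eq_zero P
      (f := fun c : Fin N → ZMod p => ∑ i, c i • β i)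
      (linearIndependent_iff_injective_fintypeLinearCombination.1 hβ) (fun c => ?_) ?_
    · rw [heval]
      simp_rw [sum_pow_char_pow, smul_pow, ZMod.pow_card_pow, Finset.mul_sum, mul_smul_comm]
      rw [Finset.sum_comm]
      simp_rw [← Finset.smul_sum, hβ0, smul_zero, Finset.sum_const_zero]
    · rw [Fintype.card_fun, ZMod.card, Fintype.card_fin]
      refine (Polynomial.natDegree_sum_le_of_forall_le (n := p ^ N - 1) _ _ fun l _ =>
        (Polynomial.natDegree_monomial_le _).trans
          (Nat.le_sub_one_of_lt (Nat.pow_lt_pow_right hp.one_lt l.2))).trans_lt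
        (Nat.sub_lt (pow_pos hp.pos _) one_pos)
  refine hv (funext fun l => ?_)
  have h := congrArg (fun Q => Q.coeff (p ^ (l : ℕ))) hP
  simp only [P, Polynomial.finsetSum_coeff, Polynomial.coeff_monomial, Polynomial.coeff_zero] at h
  rwa [Finset.sum_eq_single l (fun j _ hj => if_neg fun hjl =>
    hj (Fin.ext (Nat.pow_right_injective hp.two_le hjl))) (by simp), if_pos rfl] at h

/-- Multiplication by sufficiently high powers of elements which are linearly independent over the
prime field is jointly surjective modulo the image of the Artin–Schreier map. -/
theorem exists_forall_mul_sub_mem_range [Algebra (ZMod p) E] {N : ℕ} {β : Fin N → E}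
    (hβ : LinearIndependent (ZMod p) β) (c : Fin N → E) :
    ∃ t : E, ∀ i, β i ^ p ^ N * t - c i ∈ (artinSchreierHom E p).range := by
  let A : Matrix (Fin N) (Fin N) E := Matrix.of fun i l => β i ^ p ^ (l : ℕ)
  have hA : IsUnit A := (Matrix.isUnit_iff_isUnit_det A).2 (det_moore_ne_zero p hβ).isUnit
  obtain ⟨u, hu⟩ := Matrix.mulVec_surjective_iff_isUnit.2 hA c
  -- Modulo the image, a ≡ a^(p^k). Raising the term β_i^(p^l) u_l to the power p^(N-l) makes the
  -- power of β_i the same for all l, and avoids p-th roots.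
  refine ⟨∑ l : Fin N, u l ^ p ^ (N - l), fun i => ?_⟩
  have hi : c i = ∑ l : Fin N, β i ^ p ^ (l : ℕ) * u l := by
    rw [← hu]
    rfl
  rw [hi, Finset.mul_sum, ← Finset.sum_sub_distrib]
  refine sum_mem fun l _ => ?_
  have h := pow_char_pow_sub_self_mem_range p (β i ^ p ^ (l : ℕ) * u l) (N - l)
  rwa [mul_pow, ← pow_mul, ← pow_add, Nat.add_sub_cancel' l.2.le] at h

end ArtinSchreier

/-! ### Reduction to Artin–Schreier extensions -/

section Galois

open IntermediateField

variable {p : ℕ} [Fact p.Prime]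

/-- A field of characteristic `p` with an automorphism of order `p` contains an element which the
automorphism translates by `1`. -/
theorem exists_algEquiv_apply_eq_add_one {E N : Type*} [Field E] [Field N] [Algebra E N]
    [CharP N p] (σ : N ≃ₐ[E] N) (hσ : orderOf σ = p) :
    ∃ y : N, σ y = y + 1 := by
  -- In characteristic p, D^p = σ^p - 1 = 0. Being nilpotent and nonzero, D has an x with D x ≠ 0
  -- and D (D x) = 0; then x / D x is translated by 1.
  let D : Module.End E N := σ.toLinearMap - 1
  have hD (x : N) : D x = σ x - x := rfl
  have hDp : D ^ p = 0 := by
    have : CharP (Module.End E N) p := by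
      have : CharP E p := (algebraMap E N).charP (algebraMap E N).injective p
      exact charP_of_injective_algebraMap (algebraMap E (Module.End E N)).injective p
    have hc : Commute (σ.toLinearMap : Module.End E N) 1 := Commute.one_right _
    rw [show D = σ.toLinearMap - 1 from rfl, sub_pow_char_of_commute _ hc, one_pow, sub_eq_zero]
    ext x
    have h : ∀ k : ℕ, ((σ.toLinearMap : Module.End E N) ^ k) x = (σ ^ k) x := by
      intro k
      induction k with
      | zero => simp
      | succ k ih => rw [pow_succ', pow_succ', Module.End.mul_apply, ih]; rfl
    rw [h, ← hσ, pow_orderOf_eq_one]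
    rfl
  have hex : ∃ x : N, D x ≠ 0 ∧ D (D x) = 0 := by
    by_contra! H
    have hker : ∀ k x, (D ^ (k + 1)) x = 0 → D x = 0 := by
      intro k
      induction k with
      | zero => intro x hx; simpa using hx
      | succ k ih =>
        intro x hx
        rw [pow_succ, Module.End.mul_apply] at hx
        by_contra hx0
        exact H x hx0 (ih _ hx)
    have hp : p.Prime := Fact.out
    have hσ1 : σ = 1 := by
      ext x
      have h := hker (p - 1) x (by rw [Nat.sub_add_cancel hp.pos, hDp]; rfl)
      simpa [hD, sub_eq_zero] using h
    rw [hσ1, orderOf_one] at hσ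
    exact hp.one_lt.ne hσ
  obtain ⟨x, hx, hx'⟩ := hex
  refine ⟨x / D x, ?_⟩
  rw [hD, sub_eq_zero] at hx'
  rw [map_div₀, hx', show σ x = x + D x by rw [hD]; ring, add_div, div_self hx]

/-- If the Artin–Schreier map is surjective on every finite extension of `K`, then `p` does not
divide the degree of a finite separable extension of `K`. -/
theorem not_dvd_finrank_of_artinSchreier_surjective.{a, b} {K : Type a} [Field K] [CharP K p]
    (H : ∀ (E : Type b) [Field E] [Algebra K E] [FiniteDimensional K E] (c : E),
      ∃ z : E, z ^ p - z = c)
    (F : Type b) [Field F] [Algebra K F] [FiniteDimensional K F] [Algebra.IsSeparable K F] :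
    ¬ p ∣ Module.finrank K F := by
  intro hdvd
  have : Algebra.IsSeparable K (SeparableClosure F) := Algebra.IsSeparable.trans K F _
  have : IsSepClosure K (SeparableClosure F) := ⟨inferInstance, inferInstance⟩
  let N := normalClosure K F (SeparableClosure F)
  have hN : p ∣ Nat.card (N ≃ₐ[K] N) := by
    rw [IsGalois.card_aut_eq_finrank]
    exact hdvd.trans (Dvd.intro _ (Module.finrank_mul_finrank K F N))
  obtain ⟨τ, hτ⟩ := exists_prime_orderOf_dvd_card' p hN
  let E := fixedField (Subgroup.zpowers τ)
  have : CharP N p := charP_of_injective_algebraMap (algebraMap K N).injective p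
  have hτE (x : E) : τ x = x := (mem_fixedField_iff _ _).1 x.2 τ (Subgroup.mem_zpowers τ)
  let σ : N ≃ₐ[E] N := AlgEquiv.ofRingEquiv (f := τ.toRingEquiv) hτE
  have hσ (x : N) : σ x = τ x := rfl
  have hσo : orderOf σ = p := by
    have hpow (k : ℕ) (x : N) : (σ ^ k) x = (τ ^ k) x := by
      induction k with
      | zero => rfl
      | succ k ih => rw [pow_succ', pow_succ', AlgEquiv.mul_apply, AlgEquiv.mul_apply, ih, hσ]
    rw [← hτ]
    refine orderOf_eq_orderOf_iff.2 fun k => ?_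
    rw [AlgEquiv.ext_iff, AlgEquiv.ext_iff]
    exact forall_congr' fun x => by rw [hpow]; rfl
  have hfix (x : N) (hx : τ x = x) : x ∈ E := by
    refine (mem_fixedField_iff _ _).2 fun g hg => ?_
    have : Subgroup.zpowers τ ≤ MulAction.stabilizer (N ≃ₐ[K] N) x :=
      Subgroup.zpowers_le.2 hx
    exact this hg
  obtain ⟨y, hy⟩ := exists_algEquiv_apply_eq_add_one σ hσo
  have hyE : y ^ p - y ∈ E := hfix _ (by
    rw [map_sub, map_pow, ← hσ, hy, add_pow_char, one_pow]
    ring)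
  obtain ⟨z, hz⟩ := H E ⟨_, hyE⟩
  have hz' : (z : N) ^ p - z = y ^ p - y := congrArg Subtype.val hz
  have hroot : (y - z) ^ p = y - z := by
    rw [sub_pow_char]
    linear_combination -hz'
  -- The roots of X^p - X form the prime field, which lies in every subfield.
  have hmem : y - z ∈ E :=
    (bot_le : ⊥ ≤ E.toSubfield) ((Subfield.mem_bot_iff_pow_eq_self N p).2 hroot)
  have hyE' : y ∈ E := by simpa using add_mem hmem z.2
  have := hτE ⟨y, hyE'⟩
  rw [show τ ((⟨y, hyE'⟩ : E) : N) = y + 1 from hy] at this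
  simp at this

end Galois

namespace FirstOrder.Language

open Cardinal Set

/-! ### Type-definability for tuples and maps over K and its finite extensions -/

section FieldSets

universe u v w w'

variable {L : Language.{u, v}} {M : Type w} [L.Structure M] {κ : Cardinal.{w}}
  {K : Type w'} {n : ℕ} {e : K → Fin n → M}

/-- The tuple of elements of `M` which codes a tuple of elements of `K`. -/
def codeTuple (e : K → Fin n → M) {σ : Type} (z : σ → K) : σ × Fin n → M :=
  fun q => e (z q.1) q.2

theorem codeTuple_injective (he : Function.Injective e) {σ : Type} :
    Function.Injective (codeTuple e : (σ → K) → σ × Fin n → M) := fun _ _ h =>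
  funext fun i => he (funext fun j => congrFun h (i, j))

/-- A set of tuples of elements of `K` whose set of codes is small type-definable. -/
def FieldTypeDefinable (L : Language.{u, v}) [L.Structure M] (κ : Cardinal.{w})
    (e : K → Fin n → M) {σ : Type} (S : Set (σ → K)) : Prop :=
  L.SmallTypeDefinable κ (codeTuple e '' S)

/-- A map from tuples of elements of `K` to `K` whose graph is small type-definable. -/
def FieldMapDefinable (L : Language.{u, v}) [L.Structure M] (κ : Cardinal.{w})
    (e : K → Fin n → M) {σ : Type} (f : (σ → K) → K) : Prop :=
  L.FieldTypeDefinable κ e {z : Option σ → K | f (z ∘ some) = z none}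

theorem FieldTypeDefinable.inter (hκ : ℵ₀ ≤ κ) (he : Function.Injective e) {σ : Type}
    {S T : Set (σ → K)} (hS : L.FieldTypeDefinable κ e S) (hT : L.FieldTypeDefinable κ e T) :
    L.FieldTypeDefinable κ e (S ∩ T) := by
  rw [FieldTypeDefinable, image_inter (codeTuple_injective he)]
  exact SmallTypeDefinable.inter hκ hS hT

theorem FieldTypeDefinable.image_comp (hκ : ℵ₀ ≤ κ) (hM : L.IsSaturated M κ) {σ τ : Type}
    [Finite σ] [Finite τ] (f : σ → τ) {S : Set (τ → K)} (hS : L.FieldTypeDefinable κ e S) :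
    L.FieldTypeDefinable κ e ((fun z : τ → K => z ∘ f) '' S) := by
  have h := SmallTypeDefinable.image_comp hκ hM (Prod.map f (id : Fin n → Fin n)) hS
  rw [image_image] at h
  rw [FieldTypeDefinable, image_image]
  exact h

theorem fieldTypeDefinable_graph (hκ : ℵ₀ ≤ κ) (hM : L.IsSaturated M κ) {A : Set M} (hA : #A < κ)
    {op : K → K → K}
    (hop : L.TypeDefinable A
      (range fun z : K × K => Sum.elim (e z.1) (Sum.elim (e z.2) (e (op z.1 z.2))))) :
    L.FieldTypeDefinable κ e {w : Fin 3 → K | op (w 0) (w 1) = w 2} := by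
  have h := (hop.small hA).image_comp hκ hM
    fun q : Fin 3 × Fin n => ![Sum.inl q.2, Sum.inr (Sum.inl q.2), Sum.inr (Sum.inr q.2)] q.1
  rw [FieldTypeDefinable]
  convert! h using 1
  ext x
  constructor
  · rintro ⟨w, hw, rfl⟩
    refine ⟨_, ⟨(w 0, w 1), rfl⟩, funext fun ⟨i, j⟩ => ?_⟩
    have hw : op (w 0) (w 1) = w 2 := hw
    fin_cases i <;> simp [codeTuple, hw]
  · rintro ⟨_, ⟨⟨a, b⟩, rfl⟩, rfl⟩
    refine ⟨![a, b, op a b], rfl, funext fun ⟨i, j⟩ => ?_⟩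
    fin_cases i <;> rfl

variable [Field K] {A : Set M}

theorem FieldTypeDefinable.univ (hκ : ℵ₀ ≤ κ) (hA : #A < κ) (hK : L.IsTypeDefinableField A e)
    {σ : Type} [Finite σ] : L.FieldTypeDefinable κ e (univ : Set (σ → K)) := by
  cases nonempty_fintype σ
  have h := SmallTypeDefinable.biInter hκ (Finset.univ : Finset σ) fun i =>
    (hK.carrier.small hA).preimage_comp fun j : Fin n => (i, j)
  rw [FieldTypeDefinable]
  convert! h using 1
  ext x
  simp only [image_univ, mem_range, Finset.mem_univ, iInter_true, mem_iInter, mem_preimage]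
  constructor
  · rintro ⟨z, rfl⟩ i
    exact ⟨z i, rfl⟩
  · intro h
    choose z hz using h
    exact ⟨z, funext fun q => congrFun (hz q.1) q.2⟩

theorem FieldTypeDefinable.preimage_comp (hκ : ℵ₀ ≤ κ) (hA : #A < κ)
    (hK : L.IsTypeDefinableField A e) {σ τ : Type} [Finite τ] (f : σ → τ)
    {S : Set (σ → K)} (hS : L.FieldTypeDefinable κ e S) :
    L.FieldTypeDefinable κ e ((fun z : τ → K => z ∘ f) ⁻¹' S) := by
  have h := (SmallTypeDefinable.preimage_comp (Prod.map f (id : Fin n → Fin n)) hS).inter hκ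
    (FieldTypeDefinable.univ hκ hA hK (σ := τ))
  rw [FieldTypeDefinable]
  convert! h using 1
  ext x
  constructor
  · rintro ⟨z, hz, rfl⟩
    exact ⟨⟨z ∘ f, hz, rfl⟩, z, mem_univ _, rfl⟩
  · rintro ⟨⟨y, hy, hyx⟩, z, -, rfl⟩
    refine ⟨z, ?_, rfl⟩
    rwa [mem_preimage, ← codeTuple_injective hK.injective (a₁ := y) (a₂ := z ∘ f) hyx]

/-- The code of `a` need not lie in `A`; its finitely many coordinates become parameters. This is
why parameter sets are only required to be small. -/
theorem FieldTypeDefinable.eq_const (hκ : ℵ₀ ≤ κ) (hA : #A < κ)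
    (hK : L.IsTypeDefinableField A e) {σ : Type} [Finite σ] (i : σ) (a : K) :
    L.FieldTypeDefinable κ e {z : σ → K | z i = a} := by
  have h : L.FieldTypeDefinable κ e {fun _ : Unit => a} := by
    rw [FieldTypeDefinable, image_singleton]
    exact SmallTypeDefinable.singleton hκ _
  convert! h.preimage_comp hκ hA hK (fun _ : Unit => i) using 1
  ext z
  simp [funext_iff]

theorem FieldMapDefinable.zeros (hκ : ℵ₀ ≤ κ) (hM : L.IsSaturated M κ) (hA : #A < κ)
    (hK : L.IsTypeDefinableField A e) {σ : Type} [Finite σ] {f : (σ → K) → K}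
    (hf : L.FieldMapDefinable κ e f) : L.FieldTypeDefinable κ e {z | f z = 0} := by
  have h := (FieldTypeDefinable.inter hκ hK.injective hf
    (FieldTypeDefinable.eq_const hκ hA hK none 0)).image_comp hκ hM some
  convert! h using 1
  ext z
  constructor
  · intro hz
    exact ⟨fun i => i.elim 0 z, ⟨hz, rfl⟩, rfl⟩
  · rintro ⟨y, ⟨hy, hy0⟩, rfl⟩
    exact hy.trans hy0

theorem FieldMapDefinable.const (hκ : ℵ₀ ≤ κ) (hA : #A < κ) (hK : L.IsTypeDefinableField A e)
    {σ : Type} [Finite σ] (a : K) : L.FieldMapDefinable κ e fun _ : σ → K => a := by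
  rw [FieldMapDefinable]
  convert! FieldTypeDefinable.eq_const hκ hA hK (none : Option σ) a using 1
  ext z
  exact eq_comm

theorem FieldMapDefinable.coord (hκ : ℵ₀ ≤ κ) (hM : L.IsSaturated M κ) (hA : #A < κ)
    (hK : L.IsTypeDefinableField A e) {σ : Type} [Finite σ] (i : σ) :
    L.FieldMapDefinable κ e fun z : σ → K => z i := by
  rw [FieldMapDefinable]
  convert! (FieldTypeDefinable.univ hκ hA hK (σ := σ)).image_comp hκ hM
    (fun j : Option σ => j.elim i id) using 1
  ext z
  constructor
  · intro hz
    exact ⟨z ∘ some, mem_univ _, funext fun j => by cases j <;> [exact hz; rfl]⟩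
  · rintro ⟨y, -, rfl⟩
    rfl

theorem FieldMapDefinable.map₂ (hκ : ℵ₀ ≤ κ) (hM : L.IsSaturated M κ) (hA : #A < κ)
    (hK : L.IsTypeDefinableField A e) {op : K → K → K}
    (hop : L.FieldTypeDefinable κ e {w : Fin 3 → K | op (w 0) (w 1) = w 2})
    {σ : Type} [Finite σ] {f g : (σ → K) → K}
    (hf : L.FieldMapDefinable κ e f) (hg : L.FieldMapDefinable κ e g) :
    L.FieldMapDefinable κ e fun z => op (f z) (g z) := by
  -- The two extra variables hold the values of `f` and `g`, and are then projected away.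
  have h₁ := hf.preimage_comp hκ hA hK (τ := Option σ ⊕ Fin 2)
    fun j => j.elim (Sum.inr 0) (fun i => Sum.inl (some i))
  have h₂ := hg.preimage_comp hκ hA hK (τ := Option σ ⊕ Fin 2)
    fun j => j.elim (Sum.inr 1) (fun i => Sum.inl (some i))
  have h₃ := hop.preimage_comp hκ hA hK (τ := Option σ ⊕ Fin 2)
    ![Sum.inr 0, Sum.inr 1, Sum.inl none]
  have h := ((h₁.inter hκ hK.injective h₂).inter hκ hK.injective h₃).image_comp hκ hM Sum.inl
  rw [FieldMapDefinable]
  convert! h using 1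
  ext z
  constructor
  · intro hz
    exact ⟨Sum.elim z ![f (z ∘ some), g (z ∘ some)], ⟨⟨rfl, rfl⟩, hz⟩, rfl⟩
  · rintro ⟨y, ⟨⟨hf', hg'⟩, hop'⟩, rfl⟩
    have hf' : f (fun i => y (Sum.inl (some i))) = y (Sum.inr 0) := hf'
    have hg' : g (fun i => y (Sum.inl (some i))) = y (Sum.inr 1) := hg'
    change op (f (fun i => y (Sum.inl (some i)))) (g (fun i => y (Sum.inl (some i)))) = _
    rw [hf', hg']
    exact hop'

theorem FieldMapDefinable.add (hκ : ℵ₀ ≤ κ) (hM : L.IsSaturated M κ) (hA : #A < κ)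
    (hK : L.IsTypeDefinableField A e) {σ : Type} [Finite σ] {f g : (σ → K) → K}
    (hf : L.FieldMapDefinable κ e f) (hg : L.FieldMapDefinable κ e g) :
    L.FieldMapDefinable κ e fun z => f z + g z :=
  hf.map₂ hκ hM hA hK (fieldTypeDefinable_graph hκ hM hA hK.add) hg

theorem FieldMapDefinable.mul (hκ : ℵ₀ ≤ κ) (hM : L.IsSaturated M κ) (hA : #A < κ)
    (hK : L.IsTypeDefinableField A e) {σ : Type} [Finite σ] {f g : (σ → K) → K}
    (hf : L.FieldMapDefinable κ e f) (hg : L.FieldMapDefinable κ e g) :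
    L.FieldMapDefinable κ e fun z => f z * g z :=
  hf.map₂ hκ hM hA hK (fieldTypeDefinable_graph hκ hM hA hK.mul) hg

theorem FieldMapDefinable.sum (hκ : ℵ₀ ≤ κ) (hM : L.IsSaturated M κ) (hA : #A < κ)
    (hK : L.IsTypeDefinableField A e) {σ : Type} [Finite σ] {ι : Type*} (s : Finset ι)
    {f : ι → (σ → K) → K} (hf : ∀ i, L.FieldMapDefinable κ e (f i)) :
    L.FieldMapDefinable κ e fun z => ∑ i ∈ s, f i z := by
  classical
  induction s using Finset.induction_on with
  | empty => simpa using FieldMapDefinable.const hκ hA hK 0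
  | insert i s hi ih =>
    simp_rw [Finset.sum_insert hi]
    exact (hf i).add hκ hM hA hK ih

section FiniteExtension

variable {E : Type*} [Field E] [Algebra K E] {ι : Type} [Fintype ι] (b : Module.Basis ι K E)

/-- A map from tuples of elements of `K` to a finite extension whose coordinates have small
type-definable graphs. -/
def ExtMapDefinable (L : Language.{u, v}) [L.Structure M] (κ : Cardinal.{w})
    (e : K → Fin n → M) (b : Module.Basis ι K E) {σ : Type} (f : (σ → K) → E) : Prop :=
  ∀ i, L.FieldMapDefinable κ e fun z => b.equivFun (f z) i

variable {b} {σ : Type} [Finite σ]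

theorem ExtMapDefinable.const (hκ : ℵ₀ ≤ κ) (hA : #A < κ) (hK : L.IsTypeDefinableField A e)
    (c : E) : L.ExtMapDefinable κ e b fun _ : σ → K => c := fun _ =>
  FieldMapDefinable.const hκ hA hK _

theorem ExtMapDefinable.coords (hκ : ℵ₀ ≤ κ) (hM : L.IsSaturated M κ) (hA : #A < κ)
    (hK : L.IsTypeDefinableField A e) (f : ι → σ) :
    L.ExtMapDefinable κ e b fun z : σ → K => b.equivFun.symm (z ∘ f) := fun i => by
  simp_rw [LinearEquiv.apply_symm_apply]
  exact FieldMapDefinable.coord hκ hM hA hK (f i)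

theorem ExtMapDefinable.add (hκ : ℵ₀ ≤ κ) (hM : L.IsSaturated M κ) (hA : #A < κ)
    (hK : L.IsTypeDefinableField A e) {f g : (σ → K) → E} (hf : L.ExtMapDefinable κ e b f)
    (hg : L.ExtMapDefinable κ e b g) : L.ExtMapDefinable κ e b fun z => f z + g z := fun i => by
  simp_rw [map_add, Pi.add_apply]
  exact (hf i).add hκ hM hA hK (hg i)

theorem ExtMapDefinable.mul (hκ : ℵ₀ ≤ κ) (hM : L.IsSaturated M κ) (hA : #A < κ)
    (hK : L.IsTypeDefinableField A e) {f g : (σ → K) → E} (hf : L.ExtMapDefinable κ e b f)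
    (hg : L.ExtMapDefinable κ e b g) : L.ExtMapDefinable κ e b fun z => f z * g z := fun i => by
  -- Multiplication in coordinates, by the structure constants of the basis.
  have h (x y : E) : b.equivFun (x * y) i =
      ∑ j, ∑ k, b.equivFun x j * b.equivFun y k * b.equivFun (b j * b k) i := by
    conv_lhs => rw [← b.sum_equivFun x, ← b.sum_equivFun y, Finset.sum_mul_sum]
    simp_rw [map_sum, Finset.sum_apply, smul_mul_smul_comm, map_smul, Pi.smul_apply, smul_eq_mul]
  rw [show (fun z => b.equivFun (f z * g z) i) = _ from funext fun z => h (f z) (g z)]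
  exact FieldMapDefinable.sum hκ hM hA hK _ fun j => FieldMapDefinable.sum hκ hM hA hK _ fun k =>
    ((hf j).mul hκ hM hA hK (hg k)).mul hκ hM hA hK (FieldMapDefinable.const hκ hA hK _)

theorem ExtMapDefinable.pow (hκ : ℵ₀ ≤ κ) (hM : L.IsSaturated M κ) (hA : #A < κ)
    (hK : L.IsTypeDefinableField A e) {f : (σ → K) → E} (hf : L.ExtMapDefinable κ e b f) (m : ℕ) :
    L.ExtMapDefinable κ e b fun z => f z ^ m := by
  induction m with
  | zero => simpa using ExtMapDefinable.const hκ hA hK 1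
  | succ m ih =>
    simp_rw [pow_succ]
    exact ih.mul hκ hM hA hK hf

theorem ExtMapDefinable.sub (hκ : ℵ₀ ≤ κ) (hM : L.IsSaturated M κ) (hA : #A < κ)
    (hK : L.IsTypeDefinableField A e) {f g : (σ → K) → E} (hf : L.ExtMapDefinable κ e b f)
    (hg : L.ExtMapDefinable κ e b g) : L.ExtMapDefinable κ e b fun z => f z - g z := by
  have h : (fun z => f z - g z) = fun z => f z + -1 * g z := by
    funext z
    ring
  rw [h]
  exact hf.add hκ hM hA hK ((ExtMapDefinable.const hκ hA hK _).mul hκ hM hA hK hg)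

theorem ExtMapDefinable.zeros (hκ : ℵ₀ ≤ κ) (hM : L.IsSaturated M κ) (hA : #A < κ)
    (hK : L.IsTypeDefinableField A e) {f : (σ → K) → E} (hf : L.ExtMapDefinable κ e b f) :
    L.FieldTypeDefinable κ e {z | f z = 0} := by
  have h (s : Finset ι) : L.FieldTypeDefinable κ e {z | ∀ i ∈ s, b.equivFun (f z) i = 0} := by
    classical
    induction s using Finset.induction_on with
    | empty => simpa using FieldTypeDefinable.univ hκ hA hK
    | insert i s _ ih =>
      simp_rw [Finset.forall_mem_insert]
      exact ((hf i).zeros hκ hM hA hK).inter hκ hK.injective ih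
  convert! h Finset.univ using 1
  ext z
  rw [mem_ofPred_eq, ← b.equivFun.map_eq_zero_iff]
  simp [funext_iff]

/-- The pairs whose product is congruent to `c` modulo the image of the Artin–Schreier map. -/
theorem fieldTypeDefinable_mul_sub_mem_range (hκ : ℵ₀ ≤ κ) (hM : L.IsSaturated M κ)
    (hA : #A < κ) (hK : L.IsTypeDefinableField A e) (p : ℕ) [Fact p.Prime] [CharP E p] (c : E) :
    L.FieldTypeDefinable κ e {z : ι ⊕ ι → K | b.equivFun.symm (z ∘ Sum.inl) *
      b.equivFun.symm (z ∘ Sum.inr) - c ∈ (artinSchreierHom E p).range} := by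
  -- The third block of variables holds a preimage under the Artin–Schreier map, removed by
  -- projection.
  have hx := ExtMapDefinable.coords hκ hM hA hK (b := b)
    (fun i => (Sum.inl (Sum.inl i) : (ι ⊕ ι) ⊕ ι))
  have hy := ExtMapDefinable.coords hκ hM hA hK (b := b)
    (fun i => (Sum.inl (Sum.inr i) : (ι ⊕ ι) ⊕ ι))
  have hz := ExtMapDefinable.coords hκ hM hA hK (b := b) (fun i => (Sum.inr i : (ι ⊕ ι) ⊕ ι))
  have h := (((hz.pow hκ hM hA hK p).sub hκ hM hA hK hz).sub hκ hM hA hK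
    ((hx.mul hκ hM hA hK hy).sub hκ hM hA hK (.const hκ hA hK c))).zeros hκ hM hA hK
  convert! h.image_comp hκ hM Sum.inl using 1
  ext w
  constructor
  · rintro ⟨u, hu⟩
    refine ⟨Sum.elim w (b.equivFun u), ?_, rfl⟩
    rw [mem_ofPred_eq, sub_eq_zero]
    have : (Sum.elim w (b.equivFun u) ∘ fun i => (Sum.inr i : (ι ⊕ ι) ⊕ ι)) = b.equivFun u := rfl
    rw [this, LinearEquiv.symm_apply_apply]
    exact hu
  · rintro ⟨z, hz, rfl⟩
    exact ⟨_, sub_eq_zero.1 hz⟩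

/-- The Artin–Schreier map is surjective on every finite extension of an infinite type-definable
field in an NIP structure. -/
theorem IsTypeDefinableField.artinSchreier_surjective (hNIP : L.IsNIP M) (hκ : ℵ₀ ≤ κ)
    (hM : L.IsSaturated M κ) (hA : #A < κ) (hK : L.IsTypeDefinableField A e) [Infinite K]
    (p : ℕ) [Fact p.Prime] [CharP E p] [FiniteDimensional K E] (c : E) :
    ∃ z : E, z ^ p - z = c := by
  by_contra hc
  have hc : c ∉ (artinSchreierHom E p).range := fun ⟨z, hz⟩ => hc ⟨z, hz⟩
  let b := Module.finBasis K E
  let P (c : E) := {z : Fin (Module.finrank K E) ⊕ Fin (Module.finrank K E) → K |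
    b.equivFun.symm (z ∘ Sum.inl) * b.equivFun.symm (z ∘ Sum.inr) - c ∈
      (artinSchreierHom E p).range}
  have hdisj : Disjoint (P c) (P 0) := disjoint_left.2 fun z hz hz' => by
    have hz : _ - c ∈ (artinSchreierHom E p).range := hz
    have hz' : _ - 0 ∈ (artinSchreierHom E p).range := hz'
    exact hc (by simpa using sub_mem hz' hz)
  obtain ⟨B, D, hD, hcD, hD0⟩ := SmallTypeDefinable.exists_separating hκ hM
    (fieldTypeDefinable_mul_sub_mem_range hκ hM hA hK (b := b) p c)
    (fieldTypeDefinable_mul_sub_mem_range hκ hM hA hK (b := b) p 0)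
    ((disjoint_image_iff (codeTuple_injective hK.injective)).2 hdisj)
  -- Reindexing splits the code of a pair into the codes of its two entries, as a partitioned
  -- relation requires.
  obtain ⟨N, hN⟩ := hNIP.exists_not_shatters
    (hD.preimage_comp (Equiv.sumProdDistrib _ _ _))
  have : Infinite E := Infinite.of_injective _ (algebraMap K E).injective
  let _ := ZMod.algebra E p
  obtain ⟨β, hβ⟩ := exists_linearIndependent_of_infinite (E := E) (p := p) N
  classical
  -- Targets c on S and 0 off S put each pair in `P c` or in `P 0`, and D tells these apart.
  choose t ht using fun S : Set (Fin N) =>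
    exists_forall_mul_sub_mem_range p hβ fun i => if i ∈ S then c else 0
  refine hN ⟨fun i => codeTuple e (b.equivFun (β i ^ p ^ N)),
    fun S => codeTuple e (b.equivFun (t S)), fun i S => ?_⟩
  have hcode : (Sum.elim (codeTuple e (b.equivFun (β i ^ p ^ N)))
      (codeTuple e (b.equivFun (t S))) ∘ Equiv.sumProdDistrib _ _ _) =
      codeTuple e (Sum.elim (b.equivFun (β i ^ p ^ N)) (b.equivFun (t S))) := by
    funext ⟨x, j⟩
    rcases x with x | x <;> rfl
  have hmem (a : E) (h : β i ^ p ^ N * t S - a ∈ (artinSchreierHom E p).range) :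
      Sum.elim (b.equivFun (β i ^ p ^ N)) (b.equivFun (t S)) ∈ P a := by
    simpa only [P, mem_ofPred_eq, Sum.elim_comp_inl, Sum.elim_comp_inr,
      LinearEquiv.symm_apply_apply] using h
  rw [mem_preimage, hcode]
  have h := ht S i
  constructor
  · intro hi
    by_contra hiS
    rw [if_neg hiS] at h
    exact disjoint_left.1 hD0 hi (mem_image_of_mem _ (hmem _ h))
  · intro hiS
    rw [if_pos hiS] at h
    exact hcD (mem_image_of_mem _ (hmem _ h))

end FiniteExtension

end FieldSets

end FirstOrder.Language

theorem mainTheorem2 {L : FirstOrder.Language} {M : Type*} [L.Structure M] (hNIP : L.IsNIP M)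
    (κ : Cardinal) (hκ : Cardinal.aleph0 ≤ κ) (hM : L.IsSaturated M κ)
    (A : Set M) (hA : Cardinal.mk A < κ)
    {K : Type*} [Field K] [Infinite K] {n : ℕ} (e : K → Fin n → M)
    (hK : L.IsTypeDefinableField A e)
    (p : ℕ) (hp : p.Prime) [CharP K p]
    (F : Type*) [Field F] [Algebra K F] [FiniteDimensional K F] [Algebra.IsSeparable K F] :
    ¬ p ∣ Module.finrank K F := by
  have : Fact p.Prime := ⟨hp⟩
  refine not_dvd_finrank_of_artinSchreier_surjective (fun E _ _ _ c => ?_) F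
  have : CharP E p := charP_of_injective_algebraMap (algebraMap K E).injective p
  exact hK.artinSchreier_surjective hNIP hκ hM hA p c
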